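/- **Setting.** Let $V\subset\mathbb R^n$ be a finite set of nodes and let $\mathbb G=(V,E)$ be an undirected connected graph in which each edge is realised as the line segment between its two end-points. Each edge $e$ has a length $w_e>0$ (not necessarily the Euclidean one), and two distinct edges have at most one common point. We also write $\mathbb G\subset\mathbb R^n$ for the set of all nodes and all points of edges, with the Euclidean topology. If $x=(1-s)u+sv$ and $y=(1-t)u+tv$ lie on the edge $e$ with end-points $u,v$, the segment $\langle x,y\rangle$ has length $|t-s|\,w_e$. A path in $\mathbb G$ is a finite concatenation of such segments, and its length is the sum of theirs. The graph metric $d_{\mathbb G}(x,y)$ is the length of a shortest path from $x$ to $y$. The length measure $\omega^*$ is the Borel measure on $\mathbb G$ that on each edge $e$ is the uniform (arc-length) measure of total mass $w_e$. Fix a root $z_0\in V$ such that for all but finitely many $x\in\mathbb G$ there is exactly one shortest path from $z_0$ to $x$, and write $[z_0,x]$ for it. Let $\mathcal M(X)$ denote the set of finite nonnegative Borel measures on $X$. Let $b\ge 0$, let $w_1,w_2:\mathbb G\to[0,\infty)$ be $b$-Lipschitz with respect to $d_{\mathbb G}$, that is, $|w_i(x)-w_i(y)|\le b\,d_{\mathbb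 G}(x,y)$ for all $x,y\in\mathbb G$, and let $\lambda\in\mathbb R$ satisfy $b\lambda+w_1(z_0)+w_2(z_0)\ge 0$ (which is automatic for $\lambda\ge0$). Let $\mu,\nu\in\mathcal M(\mathbb G)$. **Entropy partial transport.** Put $$\mathrm{ET}_\lambda(\mu,\nu)=\inf_{\gamma}\Big[\int_{\mathbb G} w_1\,d\mu+\int_{\mathbb G} w_2\,d\nu-\int_{\mathbb G} w_1\,d\gamma_1-\int_{\mathbb G} w_2\,d\gamma_2+b\int_{\mathbb G\times\mathbb G}\big(d_{\mathbb G}(x,y)-\lambda\big)\,\gamma(dx,dy)\Big],$$ where $\gamma$ ranges over all measures in $\mathcal M(\mathbb G\times\mathbb G)$ whose marginals satisfy $\gamma_1\le\mu$ and $\gamma_2\le\nu$. **Unbalanced Sobolev transport.** For a nonnegative Borel measure $\omega$ on $\mathbb G$ and $1\le q\le\infty$, a continuous $f:\mathbb G\to\mathbb R$ belongs to $W^{1,q}(\mathbb G,\omega)$, with graph derivative $f'=h\in L^q(\mathbb G,\omega)$, if $$f(x)-f(z_0)=\int_{[z_0,x]}h\,d\omega\qquad\text{for all }x\in\mathbb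 G$$ (for each of the shortest paths from $z_0$ to $x$, if there are several). For $1\le p\le\infty$ with conjugate exponent $p'$ and $0\le\alpha\le\frac12[b\lambda+w_1(z_0)+w_2(z_0)]$, put $$\mathrm{US}_p^\alpha(\mu,\nu)=\sup_f\Big[\int_{\mathbb G} f\,d\mu-\int_{\mathbb G} f\,d\nu\Big],$$ where $f$ ranges over all $f\in W^{1,p'}(\mathbb G,\omega)$ with $\|f'\|_{L^{p'}(\mathbb G,\omega)}\le b$ and $-w_2(z_0)-\frac{b\lambda}2+\alpha\le f(z_0)\le w_1(z_0)+\frac{b\lambda}2-\alpha$. **Proposition 5.3.** For $\omega=\omega^*$, $$\mathrm{US}_1^0(\mu,\nu)\ \ge\ \mathrm{ET}_\lambda(\mu,\nu)+\frac{b\lambda}{2}\big[\mu(\mathbb G)+\nu(\mathbb G)\big].$$ -/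

import Mathlib

open MeasureTheory Set
open scoped ENNReal

/-- The set of points of the edge joining two points of `ℝⁿ`: the closed line segment. -/
def edgeSegment {n : ℕ} {V : Finset (EuclideanSpace ℝ (Fin n))} (e : Sym2 V) :
    Set (EuclideanSpace ℝ (Fin n)) :=
  Sym2.lift ⟨fun u v : V => segment ℝ (u : EuclideanSpace ℝ (Fin n)) v,
    fun u v => segment_symm ℝ (u : EuclideanSpace ℝ (Fin n)) v⟩ e

/-- The Euclidean distance between the two end-points of an edge. -/
noncomputable def edgeEuclideanLength {n : ℕ} {V : Finset (EuclideanSpace ℝ (Fin n))}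
    (e : Sym2 V) : ℝ :=
  Sym2.lift ⟨fun u v : V => dist (u : EuclideanSpace ℝ (Fin n)) (v : EuclideanSpace ℝ (Fin n)),
    fun u v => dist_comm (u : EuclideanSpace ℝ (Fin n)) (v : EuclideanSpace ℝ (Fin n))⟩ e

/-- A physical graph in `ℝⁿ`: finitely many nodes in `ℝⁿ`, undirected edges realised by the
line segments between their end-points, and positive edge lengths `len e` (which need not be the
Euclidean ones). The graph is connected, and two different edges do not run along each other:
as both are segments, this says that they have at most one common point. -/
structure PhysicalGraph (n : ℕ) where
  nodes : Finset (EuclideanSpace ℝ (Fin n))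
  graph : SimpleGraph nodes
  len : Sym2 nodes → ℝ
  len_pos : ∀ e ∈ graph.edgeSet, 0 < len e
  connected : graph.Connected
  inter_subsingleton : ∀ e ∈ graph.edgeSet, ∀ e' ∈ graph.edgeSet, e ≠ e' →
    (edgeSegment e ∩ edgeSegment e').Subsingleton

namespace PhysicalGraph

variable {n : ℕ} (G : PhysicalGraph n)

/-- The graph as a subset of `ℝⁿ`: all nodes and all points of the edges. -/
def carrier : Set (EuclideanSpace ℝ (Fin n)) :=
  {x | x ∈ G.nodes ∨ ∃ e ∈ G.graph.edgeSet, x ∈ edgeSegment e}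

/-- The points of the graph. Topology, Borel σ-algebra and `dist` are the ones induced from
`ℝⁿ`; in particular `dist` is the Euclidean distance, not the graph metric. -/
abbrev Pt : Type := {x : EuclideanSpace ℝ (Fin n) // x ∈ G.carrier}

/-- A node, as a point of the graph. -/
def nodePt (v : G.nodes) : G.Pt := ⟨v, Or.inl v.2⟩

/-- The points of the edge `e`, as points of the graph. -/
def edgePts (e : Sym2 G.nodes) : Set G.Pt := {x | (x : EuclideanSpace ℝ (Fin n)) ∈ edgeSegment e}

/-- The length carried by the edge `e` per unit of Euclidean length: for points
`x = (1 - s) u + s v` and `y = (1 - t) u + t v` of the edge `e` from `u` to `v`, one has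
`G.scale e * dist x y = |t - s| * G.len e`. -/
noncomputable def scale (e : Sym2 G.nodes) : ℝ := G.len e / edgeEuclideanLength e

/-- Paths in the graph between two (arbitrary) points, broken into finitely many pieces, each of
which is a line segment contained in an edge. -/
inductive Path : G.Pt → G.Pt → Type
  | nil (x : G.Pt) : Path x x
  | cons (e : Sym2 G.nodes) (he : e ∈ G.graph.edgeSet) (x y z : G.Pt)
      (hx : x ∈ G.edgePts e) (hy : y ∈ G.edgePts e) (p : Path y z) : Path x z

variable {G}

/-- The length of a path: the sum of the lengths of its pieces. -/
noncomputable def Path.length {x y : G.Pt} (p : G.Path x y) : ℝ :=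
  match p with
  | .nil _ => 0
  | .cons e _ x y _ _ _ p => G.scale e * dist x y + p.length

/-- The set of points that a path passes through. -/
def Path.support {x y : G.Pt} (p : G.Path x y) : Set G.Pt :=
  match p with
  | .nil x => {x}
  | .cons _ _ x y _ _ _ p =>
      {z | (z : EuclideanSpace ℝ (Fin n)) ∈
        segment ℝ (x : EuclideanSpace ℝ (Fin n)) (y : EuclideanSpace ℝ (Fin n))} ∪ p.support

variable (G)

/-- The graph metric: the length of the shortest path. -/
noncomputable def graphDist (x y : G.Pt) : ℝ := ⨅ p : G.Path x y, p.length

variable {G}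

/-- Shortest paths. -/
def Path.IsShortest {x y : G.Pt} (p : G.Path x y) : Prop := p.length = G.graphDist x y

variable (G)

/-- There is exactly one shortest path from `x` to `y` (as a subset of the graph). -/
def UniqueShortest (x y : G.Pt) : Prop :=
  ∃ p : G.Path x y, p.IsShortest ∧ ∀ q : G.Path x y, q.IsShortest → q.support = p.support

/-- The node `z₀` is a unique-path root: except for at most finitely many points `x` of the graph,
there is exactly one shortest path from `z₀` to `x`. (On a graph with a cycle there are
always some points with two shortest paths to the root.) -/
def IsUniquePathRoot (z₀ : G.nodes) : Prop :=
  {x : G.Pt | ¬ G.UniqueShortest (G.nodePt z₀) x}.Finite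

/-- The length measure: on each edge `e` it is the one-dimensional measure (arc length), scaled
so that the edge has total mass `len e`. -/
noncomputable def lengthMeasure : Measure G.Pt :=
  Measure.sum fun e : G.graph.edgeSet =>
    ENNReal.ofReal (G.scale e) • (Measure.hausdorffMeasure 1).restrict (G.edgePts e)

/-- `b`-Lipschitz functions with respect to the graph metric. -/
def IsLipschitz (b : ℝ) (w : G.Pt → ℝ) : Prop :=
  ∀ x y, |w x - w y| ≤ b * G.graphDist x y

/-- `h` is a graph derivative, of class `Lᵖ(ω)`, of `f`: for every point `x`,
`f x - f z₀ = ∫_{[z₀,x]} h dω`, where `[z₀,x]` is the shortest path from `z₀` to `x`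
(each of them, for the exceptional points `x` that have several). -/
def IsGraphDeriv (z₀ : G.nodes) (ω : Measure G.Pt) (p : ℝ≥0∞) (f h : G.Pt → ℝ) : Prop :=
  MemLp h p ω ∧ ∀ (x : G.Pt) (P : G.Path (G.nodePt z₀) x), P.IsShortest →
    IntegrableOn h P.support ω ∧ f x - f (G.nodePt z₀) = ∫ y in P.support, h y ∂ω

/-- The graph-based Sobolev space `W^{1,p}(G, ω)`. -/
def sobolevSpace (z₀ : G.nodes) (ω : Measure G.Pt) (p : ℝ≥0∞) : Set (G.Pt → ℝ) :=
  {f | Continuous f ∧ ∃ h, G.IsGraphDeriv z₀ ω p f h}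

/-- The set `𝕌_q^α` of critics: `f ∈ W^{1,q}(G, ω)` with `f z₀` in the interval
`[-w₂(z₀) - bλ/2 + α, w₁(z₀) + bλ/2 - α]` and `‖f'‖_{L^q(ω)} ≤ b`. -/
def criticSet (z₀ : G.nodes) (ω : Measure G.Pt) (b lam : ℝ) (w₁ w₂ : G.Pt → ℝ)
    (q : ℝ≥0∞) (α : ℝ) : Set (G.Pt → ℝ) :=
  {f | f ∈ G.sobolevSpace z₀ ω q ∧
    f (G.nodePt z₀) ∈ Icc (-w₂ (G.nodePt z₀) - b * lam / 2 + α)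
      (w₁ (G.nodePt z₀) + b * lam / 2 - α) ∧
    ∃ h, G.IsGraphDeriv z₀ ω q f h ∧ eLpNorm h q ω ≤ ENNReal.ofReal b}

/-- Unbalanced Sobolev transport `US_p^α(μ, ν)`: the supremum of `∫ f dμ - ∫ f dν` over the
critics in `𝕌_{p'}^α`, with `p'` the conjugate exponent of `p`. The supremum is taken in the
extended reals. -/
noncomputable def US (z₀ : G.nodes) (ω : Measure G.Pt) (b lam : ℝ) (w₁ w₂ : G.Pt → ℝ)
    (p : ℝ≥0∞) (α : ℝ) (μ ν : Measure G.Pt) : EReal :=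
  ⨆ f ∈ G.criticSet z₀ ω b lam w₁ w₂ (ENNReal.conjExponent p) α,
    ((∫ x, f x ∂μ - ∫ x, f x ∂ν : ℝ) : EReal)

end PhysicalGraph

/-- Sub-couplings: finite measures on `X × X` whose marginals are dominated by `μ` and `ν`. -/
def subCouplings {X : Type*} [MeasurableSpace X] (μ ν : Measure X) : Set (Measure (X × X)) :=
  {γ | IsFiniteMeasure γ ∧ γ.fst ≤ μ ∧ γ.snd ≤ ν}

/-- The entropy partial transport functional `𝒞_λ(γ)` with weights `w₁, w₂`, constant `b` and
cost `c`. -/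
noncomputable def eptCost {X : Type*} [MeasurableSpace X] (b lam : ℝ) (w₁ w₂ : X → ℝ)
    (c : X → X → ℝ) (μ ν : Measure X) (γ : Measure (X × X)) : ℝ :=
  ∫ x, w₁ x ∂μ + ∫ x, w₂ x ∂ν - ∫ x, w₁ x ∂γ.fst - ∫ x, w₂ x ∂γ.snd
    + b * ∫ z, (c z.1 z.2 - lam) ∂γ

/-- Entropy partial transport `ET_{c,λ}(μ, ν)`: the infimum (in the extended reals) of `𝒞_λ(γ)`
over all sub-couplings `γ`. -/
noncomputable def EPT {X : Type*} [MeasurableSpace X] (b lam : ℝ) (w₁ w₂ : X → ℝ)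
    (c : X → X → ℝ) (μ ν : Measure X) : EReal :=
  ⨅ γ ∈ subCouplings μ ν, ((eptCost b lam w₁ w₂ c μ ν γ : ℝ) : EReal)

/-- `ET_λ`: entropy partial transport on a graph, with the graph metric as the cost. -/
noncomputable def PhysicalGraph.ET {n : ℕ} (G : PhysicalGraph n) (b lam : ℝ)
    (w₁ w₂ : G.Pt → ℝ) (μ ν : Measure G.Pt) : EReal :=
  EPT b lam w₁ w₂ G.graphDist μ ν

/-!
The inequality is strong duality for partial transport, combined with the fact that a function that
is `b`-Lipschitz for the graph metric has a graph derivative bounded by `b`.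

*Duality.* Up to the constant `∫ w₁ dμ + ∫ w₂ dν`, the cost of a sub-coupling `γ` is `∫ k dγ` with
`k (x, y) = b (d(x, y) - λ) - w₁ x - w₂ y` (`PhysicalGraph.eptCost_eq`). The graph is compact and
`k` is continuous, so `k` is nearly constant on the products of the cells of a fine finite
partition. Finite linear programming duality, proved by Hahn-Banach separation
(`exists_partialTransport_dual`), and spreading the finite plan over the cells (`cellPlan`) give,
for each `ε > 0`, a sub-coupling `γ` and functions `u, v ≤ 0` with `u x + v y ≤ k (x, y)` and
`∫ k dγ ≤ ∫ u dμ + ∫ v dν + ε` (`exists_subCoupling_integral_le`).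

*One potential.* With `g = w₂ + v + bλ/2`, the function
`f x = min (inf_y (b d(x, y) - g y)) (w₁ x + bλ/2)` is `b`-Lipschitz, and `w₁ + u + bλ/2 ≤ f ≤ -g`.
The condition on `λ` is what puts `f z₀` into the prescribed interval
(`PhysicalGraph.exists_isLipschitz_of_dual`).

*Derivative.* On each edge, parametrized by arc length, `f` and the distance `r` to the root are
Lipschitz. The product of their derivatives is the derivative of `f` in the direction of growing
`r`, and it is bounded by `b`. Along a shortest path from the root, `r` grows at unit speed, so the
fundamental theorem of calculus for Lipschitz functions gives the increment of `f` on each piece;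
and since the pieces occupy consecutive ranges of `r`, they overlap only in null sets
(`PhysicalGraph.Path.setIntegral_support_radialDeriv`). So `f` is an admissible critic, and its value
is at least the shifted cost of `γ` minus `ε`.
-/

/-! ### Duality for finite partial transport -/

/-- Strong duality, up to `ε`, for the finite partial transport problem with costs `k` of arbitrary
sign. The compact convex set of pairs (cost, marginals) of the plans with entries in `[0, R]` is
separated from the closed orthant of the pairs that would beat the optimal plan by `ε / 2`. The
separating functional satisfies the dual constraints up to an error of order `1 / R`, which is then
subtracted from one of the potentials. The masses `a i` and `c j` may vanish. -/
theorem exists_partialTransport_dual {I J : Type*} [Fintype I] [Fintype J] (k : I → J → ℝ)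
    {a : I → ℝ} {c : J → ℝ} (ha : ∀ i, 0 ≤ a i) (hc : ∀ j, 0 ≤ c j) {ε : ℝ} (hε : 0 < ε) :
    ∃ (θ : I → J → ℝ) (u : I → ℝ) (v : J → ℝ), (∀ i j, 0 ≤ θ i j) ∧ (∀ i, ∑ j, θ i j ≤ a i) ∧
      (∀ j, ∑ i, θ i j ≤ c j) ∧ (∀ i, u i ≤ 0) ∧ (∀ j, v j ≤ 0) ∧ (∀ i j, u i + v j ≤ k i j) ∧
      ∑ i, ∑ j, θ i j * k i j ≤ ∑ i, u i * a i + ∑ j, v j * c j + ε := by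
  classical
  let cost : (I → J → ℝ) → ℝ := fun θ => ∑ i, ∑ j, θ i j * k i j
  have hcost : Continuous cost := by fun_prop
  let K : Set (I → J → ℝ) := {θ | (0 ≤ θ) ∧ (∀ i, ∑ j, θ i j ≤ a i) ∧ (∀ j, ∑ i, θ i j ≤ c j)}
  have hKc : IsCompact K := by
    refine (isCompact_Icc (a := (0 : I → J → ℝ)) (b := fun i _ => a i)).of_isClosed_subset ?_ ?_
    · simp only [K, Set.ofPred_and, Set.ofPred_forall]
      exact isClosed_Ici.inter (IsClosed.inter
        (isClosed_iInter fun i => isClosed_le (by fun_prop) (by fun_prop))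
        (isClosed_iInter fun i => isClosed_le (by fun_prop) (by fun_prop)))
    · rintro θ ⟨h0, h1, -⟩
      exact ⟨h0, fun i j => (Finset.single_le_sum (f := fun j => θ i j)
        (fun j _ => h0 i j) (Finset.mem_univ j)).trans (h1 i)⟩
  have h0K : (0 : I → J → ℝ) ∈ K := ⟨le_rfl, by simpa using ha, by simpa using hc⟩
  obtain ⟨θ, hθK, hθmin⟩ := hKc.exists_isMinOn ⟨0, h0K⟩ hcost.continuousOn
  set V := cost θ with hV
  have hV0 : V ≤ 0 := by simpa [cost] using hθmin h0K
  set ε' := ε / 2 with hε'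
  have hε'0 : 0 < ε' := by positivity
  have hA : 0 ≤ ∑ i, a i := Finset.sum_nonneg fun i _ => ha i
  -- `δ` is the violation of the dual constraints; removing it costs `δ * ∑ i, a i ≤ ε'`
  set δ := ε' / (∑ i, a i + 1) with hδ
  have hδ0 : 0 < δ := by positivity
  set R := (ε' - V) / δ with hR
  have hR0 : 0 < R := div_pos (by linarith) hδ0
  -- the cost and the marginals of a transport plan, as one linear map
  let Λ : (I → J → ℝ) →ₗ[ℝ] ℝ × (I → ℝ) × (J → ℝ) :=
    { toFun := fun θ => (∑ i, ∑ j, θ i j * k i j, fun i => ∑ j, θ i j, fun j => ∑ i, θ i j)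
      map_add' := fun x y => by
        ext <;> simp [add_mul, Finset.sum_add_distrib]
      map_smul' := fun r x => by
        ext <;> simp [Finset.mul_sum, mul_assoc] }
  have hΛ : Continuous Λ := Λ.continuous_of_finiteDimensional
  obtain ⟨f, s, s', hfT, hss, hfQ⟩ := geometric_hahn_banach_compact_closed
    (s := Λ '' Icc 0 (fun _ _ => R)) (t := Iic (V - ε', a, c))
    ((convex_Icc _ _).linear_image Λ) (isCompact_Icc.image hΛ) (convex_Iic _) isClosed_Iic (by
      rw [Set.disjoint_left]
      rintro _ ⟨η, hη, rfl⟩ ⟨h1, h2, h3⟩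
      have : V ≤ cost η := hθmin ⟨hη.1, h2, h3⟩
      have h1' : cost η ≤ V - ε' := h1
      linarith)
  set τ := f (1, 0, 0) with hτ
  let u : I → ℝ := fun i => f (0, Pi.single i 1, 0)
  let v : J → ℝ := fun j => f (0, 0, Pi.single j 1)
  have hf : ∀ t p q, f (t, p, q) = τ * t + ∑ i, u i * p i + ∑ j, v j * q j := by
    intro t p q
    have e1 : ((t, p, q) : ℝ × (I → ℝ) × (J → ℝ)) = t • (1, 0, 0)
        + ∑ i, p i • (0, Pi.single i 1, 0) + ∑ j, q j • (0, 0, Pi.single j 1) := by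
      refine Prod.ext ?_ (Prod.ext ?_ ?_)
      · simp [Prod.fst_sum]
      · funext i
        simp [Prod.snd_sum, Prod.fst_sum, Finset.sum_apply, Pi.single_apply]
      · funext i
        simp [Prod.snd_sum, Finset.sum_apply, Pi.single_apply]
    rw [e1]
    simp only [map_add, map_sum, map_smul, smul_eq_mul]
    simp only [τ, u, v, mul_comm]
  set D := f (V - ε', a, c) with hD
  have hsD : s' < D := hfQ _ self_mem_Iic
  -- the orthant is unbounded below, so the functional has nonpositive coefficients
  have neg_of : ∀ r : ℝ, (∀ m : ℝ, 0 ≤ m → s' < D - m * r) → r ≤ 0 := by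
    intro r h
    by_contra hr
    push Not at hr
    have := h ((D - s') / r) (div_nonneg (by linarith) hr.le)
    rw [div_mul_cancel₀ _ hr.ne'] at this
    linarith
  have hτ0 : τ ≤ 0 := neg_of _ fun m hm => by
    have := hfQ (V - ε' - m, a, c) ⟨by simpa using hm, le_rfl⟩
    rw [hf] at this
    rw [hD, hf]
    linarith
  have hu0 : ∀ i, u i ≤ 0 := fun i => neg_of _ fun m hm => by
    have := hfQ ((V - ε', a, c) - m • ((0, Pi.single i 1, 0) : ℝ × (I → ℝ) × (J → ℝ)))
      (mem_Iic.2 <| sub_le_self _ (smul_nonneg hm (Prod.mk_le_mk.2 ⟨le_rfl, Prod.mk_le_mk.2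
        ⟨Pi.single_nonneg.2 zero_le_one, le_rfl⟩⟩)))
    rwa [map_sub, map_smul] at this
  have hv0 : ∀ j, v j ≤ 0 := fun j => neg_of _ fun m hm => by
    have := hfQ ((V - ε', a, c) - m • ((0, 0, Pi.single j 1) : ℝ × (I → ℝ) × (J → ℝ)))
      (mem_Iic.2 <| sub_le_self _ (smul_nonneg hm (Prod.mk_le_mk.2 ⟨le_rfl, Prod.mk_le_mk.2
        ⟨le_rfl, Pi.single_nonneg.2 zero_le_one⟩⟩)))
    rwa [map_sub, map_smul] at this
  have hD0 : 0 < D := by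
    have := hfT (Λ 0) ⟨0, ⟨le_rfl, fun _ _ => hR0.le⟩, rfl⟩
    rw [map_zero, map_zero] at this
    linarith
  have hua : ∑ i, u i * a i ≤ 0 :=
    Finset.sum_nonpos fun i _ => mul_nonpos_of_nonpos_of_nonneg (hu0 i) (ha i)
  have hvc : ∑ j, v j * c j ≤ 0 :=
    Finset.sum_nonpos fun i _ => mul_nonpos_of_nonpos_of_nonneg (hv0 i) (hc i)
  have hDe : D = τ * (V - ε') + ∑ i, u i * a i + ∑ j, v j * c j := hf _ _ _
  -- a vertical separating hyperplane is impossible, even where masses vanish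
  have hτneg : τ < 0 := lt_of_le_of_ne hτ0 fun h => by
    rw [h, zero_mul] at hDe
    linarith
  -- testing the separation against the plan that moves mass `R` from `i` to `j`
  have hviol : ∀ i j, R * (τ * k i j + u i + v j) < -τ * (ε' - V) := by
    intro i j
    have := hfT (Λ (Pi.single i (Pi.single j R)))
      ⟨_, ⟨Pi.single_nonneg.2 (Pi.single_nonneg.2 hR0.le), by
        intro i' j'
        rw [Pi.single_apply]
        split_ifs
        · rw [Pi.single_apply]
          split_ifs
          · exact le_rfl
          · exact hR0.le
        · exact hR0.le⟩, rfl⟩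
    have e : f (Λ (Pi.single i (Pi.single j R))) = R * (τ * k i j + u i + v j) := by
      change f (_, _, _) = _
      rw [hf]
      have e1 : ∀ i', ∑ j', (Pi.single i (Pi.single j R) : I → J → ℝ) i' j' * k i' j'
          = if i' = i then R * k i j else 0 := by
        intro i'
        by_cases h : i' = i
        · subst h
          simp [Pi.single_apply]
        · simp [h]
      have e2 : ∀ i', ∑ j', (Pi.single i (Pi.single j R) : I → J → ℝ) i' j'
          = if i' = i then R else 0 := by
        intro i'
        by_cases h : i' = i
        · subst h
          simp [Pi.single_apply]
        · simp [h]
      have e3 : ∀ j', ∑ i', (Pi.single i (Pi.single j R) : I → J → ℝ) i' j'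
          = if j' = j then R else 0 := by
        intro j'
        rw [Finset.sum_eq_single i]
        · simp [Pi.single_apply]
        · intro i' _ h
          simp [h]
        · simp
      simp only [e1, e2, e3]
      simp
      ring
    rw [e] at this
    rw [hDe] at hsD
    nlinarith
  refine ⟨θ, fun i => u i / (-τ) - δ, fun j => v j / (-τ), fun i j => hθK.1 i j, hθK.2.1, hθK.2.2,
    ?_, ?_, ?_, ?_⟩
  · intro i
    have := div_nonpos_of_nonpos_of_nonneg (hu0 i) (neg_pos.2 hτneg).le
    linarith
  · intro j
    exact div_nonpos_of_nonpos_of_nonneg (hv0 j) (neg_pos.2 hτneg).le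
  · intro i j
    have h1 : τ * k i j + u i + v j < -τ * δ := by
      have h2 := hviol i j
      have h3 : ε' - V = R * δ := by rw [hR, div_mul_cancel₀ _ hδ0.ne']
      rw [h3] at h2
      have h4 : R * (τ * k i j + u i + v j) < R * (-τ * δ) := by linarith
      exact lt_of_mul_lt_mul_left h4 hR0.le
    have h5 : u i / (-τ) + v j / (-τ) = (u i + v j) / (-τ) := by ring
    have h6 : (u i + v j) / (-τ) ≤ k i j + δ := by
      rw [div_le_iff₀ (neg_pos.2 hτneg)]
      linarith
    linarith
  · have e1 : ∑ i, (u i / (-τ) - δ) * a i = (∑ i, u i * a i) / (-τ) - δ * ∑ i, a i := by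
      rw [Finset.sum_div, Finset.mul_sum, ← Finset.sum_sub_distrib]
      exact Finset.sum_congr rfl fun i _ => by ring
    have e2 : ∑ j, v j / (-τ) * c j = (∑ j, v j * c j) / (-τ) := by
      rw [Finset.sum_div]
      exact Finset.sum_congr rfl fun i _ => by ring
    have e3 : δ * ∑ i, a i ≤ ε' := by
      have : δ * (∑ i, a i + 1) = ε' := div_mul_cancel₀ _ (by positivity)
      linarith
    have e4 : V - ε' < (∑ i, u i * a i) / (-τ) + (∑ j, v j * c j) / (-τ) := by
      rw [← add_div, lt_div_iff₀ (neg_pos.2 hτneg)]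
      linarith
    have e5 : ∑ i, ∑ j, θ i j * k i j = V := rfl
    rw [e1, e2, e5]
    linarith

/-! ### Duality for partial transport between finite measures -/

theorem integral_comp_fintype {X N : Type*} [MeasurableSpace X] [Fintype N] [MeasurableSpace N]
    [MeasurableSingletonClass N] (μ : Measure X) [IsFiniteMeasure μ] {π : X → N}
    (hπ : Measurable π) (u : N → ℝ) :
    ∫ x, u (π x) ∂μ = ∑ i, u i * μ.real (π ⁻¹' {i}) := by
  have hu : Measurable u := measurable_of_countable u
  rw [← integral_map (f := u) hπ.aemeasurable hu.aestronglyMeasurable,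
    integral_fintype (Integrable.of_finite)]
  refine Finset.sum_congr rfl fun i _ => ?_
  rw [map_measureReal_apply hπ (measurableSet_singleton i), smul_eq_mul, mul_comm]

/-- The plan that spreads the mass `θ i j` over the product of the `i`-th and the `j`-th cell,
proportionally to the product measure. Cells of measure zero contribute nothing, since division
by zero gives zero. -/
noncomputable def cellPlan {X N : Type*} [MeasurableSpace X] [Fintype N] (μ ν : Measure X)
    (π : X → N) (θ : N → N → ℝ) : Measure (X × X) :=
  ∑ i, ∑ j, ENNReal.ofReal (θ i j / (μ.real (π ⁻¹' {i}) * ν.real (π ⁻¹' {j}))) •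
    (μ.restrict (π ⁻¹' {i})).prod (ν.restrict (π ⁻¹' {j}))

theorem sum_div_mul_le_one {N : Type*} [Fintype N] {θ : N → ℝ} {a : ℝ} {c : N → ℝ}
    (hθ : ∀ j, 0 ≤ θ j) (hs : ∑ j, θ j ≤ a) :
    ∑ j, θ j / (a * c j) * c j ≤ 1 := by
  have ha : 0 ≤ a := (Finset.sum_nonneg fun j _ => hθ j).trans hs
  calc ∑ j, θ j / (a * c j) * c j ≤ ∑ j, θ j / a := by
        refine Finset.sum_le_sum fun j _ => ?_
        by_cases hc : c j = 0
        · simpa [hc] using div_nonneg (hθ j) ha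
        · rw [div_mul_eq_mul_div, mul_div_mul_right _ _ hc]
    _ = (∑ j, θ j) / a := by rw [Finset.sum_div]
    _ ≤ 1 := div_le_one_of_le₀ hs ha

theorem sum_measure_inter_fiber {X N : Type*} [MeasurableSpace X] [Fintype N] [MeasurableSpace N]
    [MeasurableSingletonClass N] (μ : Measure X) {π : X → N} (hπ : Measurable π) (s : Set X) :
    ∑ i, μ (s ∩ π ⁻¹' {i}) = μ s := by
  have := sum_measure_preimage_singleton (μ := μ.restrict s) (f := π) Finset.univ
    (fun i _ => hπ (measurableSet_singleton i))
  simp only [Finset.coe_univ, preimage_univ, Measure.restrict_apply_univ] at this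
  rw [← this]
  refine Finset.sum_congr rfl fun i _ => ?_
  rw [Measure.restrict_apply (hπ (measurableSet_singleton i)), inter_comm]

section

variable {X N : Type*} [MeasurableSpace X] [Fintype N] [MeasurableSpace N]
  [MeasurableSingletonClass N] {μ ν : Measure X}
  {π : X → N} {θ : N → N → ℝ}

theorem cellPlan_fst_le [IsFiniteMeasure ν] (hπ : Measurable π)
    (hθ : ∀ i j, 0 ≤ θ i j)
    (h : ∀ i, ∑ j, θ i j ≤ μ.real (π ⁻¹' {i})) : (cellPlan μ ν π θ).fst ≤ μ := by
  refine Measure.le_iff.2 fun s hs => ?_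
  rw [Measure.fst_apply hs, ← sum_measure_inter_fiber μ hπ s, ← prod_univ]
  simp only [cellPlan, Measure.finsetSum_apply, Measure.smul_apply, Measure.prod_prod,
    Measure.restrict_apply_univ, smul_eq_mul, Measure.restrict_apply hs]
  refine Finset.sum_le_sum fun i _ => ?_
  have e : ∀ j, ENNReal.ofReal (θ i j / (μ.real (π ⁻¹' {i}) * ν.real (π ⁻¹' {j}))) *
      (μ (s ∩ π ⁻¹' {i}) * ν (π ⁻¹' {j})) = μ (s ∩ π ⁻¹' {i}) *
        ENNReal.ofReal (θ i j / (μ.real (π ⁻¹' {i}) * ν.real (π ⁻¹' {j})) *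
          ν.real (π ⁻¹' {j})) := by
    intro j
    rw [ENNReal.ofReal_mul (div_nonneg (hθ i j) (by positivity)), ofReal_measureReal]
    ring
  simp only [e]
  rw [← Finset.mul_sum, ← ENNReal.ofReal_sum_of_nonneg fun j _ =>
    mul_nonneg (div_nonneg (hθ i j) (by positivity)) measureReal_nonneg]
  exact mul_le_of_le_one_right' (ENNReal.ofReal_le_one.2 (sum_div_mul_le_one (hθ i) (h i)))

theorem cellPlan_snd_le [IsFiniteMeasure μ] [IsFiniteMeasure ν] (hπ : Measurable π)
    (hθ : ∀ i j, 0 ≤ θ i j)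
    (h : ∀ j, ∑ i, θ i j ≤ ν.real (π ⁻¹' {j})) : (cellPlan μ ν π θ).snd ≤ ν := by
  refine Measure.le_iff.2 fun s hs => ?_
  rw [Measure.snd_apply hs, ← sum_measure_inter_fiber ν hπ s, ← univ_prod]
  simp only [cellPlan, Measure.finsetSum_apply, Measure.smul_apply, Measure.prod_prod,
    Measure.restrict_apply_univ, smul_eq_mul, Measure.restrict_apply hs]
  rw [Finset.sum_comm]
  refine Finset.sum_le_sum fun j _ => ?_
  have e : ∀ i, ENNReal.ofReal (θ i j / (μ.real (π ⁻¹' {i}) * ν.real (π ⁻¹' {j}))) *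
      (μ (π ⁻¹' {i}) * ν (s ∩ π ⁻¹' {j})) = ν (s ∩ π ⁻¹' {j}) *
        ENNReal.ofReal (θ i j / (ν.real (π ⁻¹' {j}) * μ.real (π ⁻¹' {i})) *
          μ.real (π ⁻¹' {i})) := by
    intro i
    rw [ENNReal.ofReal_mul (div_nonneg (hθ i j) (by positivity)), ofReal_measureReal,
      mul_comm (ν.real _)]
    ring
  simp only [e]
  rw [← Finset.mul_sum, ← ENNReal.ofReal_sum_of_nonneg fun i _ =>
    mul_nonneg (div_nonneg (hθ i j) (by positivity)) measureReal_nonneg]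
  exact mul_le_of_le_one_right'
    (ENNReal.ofReal_le_one.2 (sum_div_mul_le_one (fun i => hθ i j) (h j)))

theorem integral_cellPlan_le [IsFiniteMeasure μ] [IsFiniteMeasure ν] (hπ : Measurable π)
    (hθ : ∀ i j, 0 ≤ θ i j)
    (h₁ : ∀ i, ∑ j, θ i j ≤ μ.real (π ⁻¹' {i})) (h₂ : ∀ j, ∑ i, θ i j ≤ ν.real (π ⁻¹' {j}))
    {k : X × X → ℝ} (hk : ∀ γ : Measure (X × X), IsFiniteMeasure γ → Integrable k γ)
    {κ : N → N → ℝ} (hκ : ∀ x y, k (x, y) ≤ κ (π x) (π y)) :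
    ∫ z, k z ∂(cellPlan μ ν π θ) ≤ ∑ i, ∑ j, θ i j * κ i j := by
  have hfin : ∀ i j, IsFiniteMeasure (ENNReal.ofReal (θ i j /
      (μ.real (π ⁻¹' {i}) * ν.real (π ⁻¹' {j}))) •
        (μ.restrict (π ⁻¹' {i})).prod (ν.restrict (π ⁻¹' {j}))) :=
    fun i j => Measure.smul_finite _ ENNReal.ofReal_ne_top
  have hint := fun i j => hk _ (hfin i j)
  rw [cellPlan, integral_finsetSum_measure fun i _ =>
    integrable_finsetSum_measure.2 fun j _ => hint i j]
  refine Finset.sum_le_sum fun i _ => ?_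
  rw [integral_finsetSum_measure fun j _ => hint i j]
  refine Finset.sum_le_sum fun j _ => ?_
  have hθ0 : μ.real (π ⁻¹' {i}) * ν.real (π ⁻¹' {j}) = 0 → θ i j = 0 := by
    intro h0
    refine le_antisymm ?_ (hθ i j)
    rcases mul_eq_zero.1 h0 with h0 | h0
    · exact (Finset.single_le_sum (f := fun j => θ i j) (fun j _ => hθ i j)
        (Finset.mem_univ j)).trans ((h₁ i).trans h0.le)
    · exact (Finset.single_le_sum (f := fun i => θ i j) (fun i _ => hθ i j)
        (Finset.mem_univ i)).trans ((h₂ j).trans h0.le)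
  have hle : ∫ z, k z ∂((μ.restrict (π ⁻¹' {i})).prod (ν.restrict (π ⁻¹' {j}))) ≤
      κ i j * (μ.real (π ⁻¹' {i}) * ν.real (π ⁻¹' {j})) := by
    have hm : MeasurableSet ((π ⁻¹' {i}) ×ˢ (π ⁻¹' {j})) :=
      (hπ (measurableSet_singleton i)).prod (hπ (measurableSet_singleton j))
    have h1 : ∫ z, k z ∂((μ.restrict (π ⁻¹' {i})).prod (ν.restrict (π ⁻¹' {j}))) ≤
        ∫ _, κ i j ∂((μ.restrict (π ⁻¹' {i})).prod (ν.restrict (π ⁻¹' {j}))) := by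
      refine integral_mono_ae (hk _ inferInstance) (integrable_const _) ?_
      rw [Measure.prod_restrict]
      filter_upwards [ae_restrict_mem hm] with z hz
      obtain ⟨h1, h2⟩ := hz
      simp only [mem_preimage, mem_singleton_iff] at h1 h2
      simpa [h1, h2] using hκ z.1 z.2
    refine h1.trans (le_of_eq ?_)
    rw [integral_const, smul_eq_mul, mul_comm, Measure.prod_restrict,
      measureReal_restrict_apply_univ, measureReal_prod_prod]
  rw [integral_smul_measure, ENNReal.toReal_ofReal (div_nonneg (hθ i j) (by positivity)),
    smul_eq_mul]
  refine (mul_le_mul_of_nonneg_left hle (div_nonneg (hθ i j) (by positivity))).trans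
    (le_of_eq ?_)
  by_cases h0 : μ.real (π ⁻¹' {i}) * ν.real (π ⁻¹' {j}) = 0
  · simp [hθ0 h0]
  · rw [mul_comm (κ i j), ← mul_assoc, div_mul_cancel₀ _ h0]

/-- Duality, up to a multiple of `ε`, for partial transport between finite measures, for a cost `k`
that is within `ε` of a function `κ` of the cells of a finite measurable partition `π`. -/
theorem exists_subCoupling_integral_le (μ ν : Measure X) [IsFiniteMeasure μ] [IsFiniteMeasure ν]
    (hπ : Measurable π)
    {k : X × X → ℝ} (hk : ∀ γ : Measure (X × X), IsFiniteMeasure γ → Integrable k γ)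
    {κ : N → N → ℝ} {ε : ℝ} (hε : 0 < ε) (hκ : ∀ x y, κ (π x) (π y) ≤ k (x, y))
    (hκ' : ∀ x y, k (x, y) ≤ κ (π x) (π y) + ε) :
    ∃ γ ∈ subCouplings μ ν, ∃ u v : X → ℝ, Integrable u μ ∧ Integrable v ν ∧
      (∀ x, u x ≤ 0) ∧ (∀ y, v y ≤ 0) ∧ (∀ x y, u x + v y ≤ k (x, y)) ∧
      ∫ z, k z ∂γ ≤ ∫ x, u x ∂μ + ∫ y, v y ∂ν + ε * (μ.real univ + 1) := by
  obtain ⟨θ, u, v, hθ, h1, h2, hu, hv, huv, hval⟩ := exists_partialTransport_dual κ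
    (a := fun i => μ.real (π ⁻¹' {i})) (c := fun j => ν.real (π ⁻¹' {j}))
    (fun _ => measureReal_nonneg) (fun _ => measureReal_nonneg) hε
  have hint : ∀ (η : Measure X) [IsFiniteMeasure η] (w : N → ℝ),
      Integrable (fun x => w (π x)) η := fun η _ w =>
    (Integrable.of_finite (f := w) (μ := η.map π)).comp_measurable hπ
  refine ⟨cellPlan μ ν π θ, ⟨⟨?_⟩, cellPlan_fst_le hπ hθ h1, cellPlan_snd_le hπ hθ h2⟩,
    fun x => u (π x), fun y => v (π y), hint μ u, hint ν v, fun x => hu _, fun y => hv _,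
    fun x y => (huv _ _).trans (hκ x y), ?_⟩
  · rw [← Measure.fst_univ]
    exact ((cellPlan_fst_le hπ hθ h1) univ).trans_lt (measure_lt_top μ univ)
  · refine (integral_cellPlan_le hπ hθ h1 h2 hk
      (κ := fun i j => κ i j + ε) hκ').trans ?_
    rw [integral_comp_fintype μ hπ, integral_comp_fintype ν hπ]
    have e : ∑ i, ∑ j, θ i j * (κ i j + ε) = ∑ i, ∑ j, θ i j * κ i j + ε * ∑ i, ∑ j, θ i j := by
      simp only [mul_add, Finset.sum_add_distrib, Finset.sum_mul, mul_comm ε]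
    have hμ : ∑ i, μ.real (π ⁻¹' {i}) = μ.real univ := by
      simpa using (integral_comp_fintype μ hπ (fun _ => (1 : ℝ))).symm
    have hm : ∑ i, ∑ j, θ i j ≤ μ.real univ := by
      rw [← hμ]
      exact Finset.sum_le_sum fun i _ => h1 i
    rw [e]
    nlinarith

end

/-! ### The graph metric -/

namespace PhysicalGraph

variable {n : ℕ} {G : PhysicalGraph n}

theorem edgeEuclideanLength_pos {e : Sym2 G.nodes} (he : e ∈ G.graph.edgeSet) :
    0 < edgeEuclideanLength e := by
  induction e with
  | _ u v =>
    have h : u ≠ v := G.graph.ne_of_adj he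
    exact dist_pos.2 fun h' => h (Subtype.ext h')

theorem scale_pos {e : Sym2 G.nodes} (he : e ∈ G.graph.edgeSet) : 0 < G.scale e :=
  div_pos (G.len_pos e he) (edgeEuclideanLength_pos he)

theorem isCompact_edgeSegment (e : Sym2 G.nodes) : IsCompact (edgeSegment e) := by
  induction e with
  | _ u v =>
    change IsCompact (segment ℝ (u : EuclideanSpace ℝ (Fin n)) v)
    rw [← convexHull_pair]
    exact (Set.toFinite _).isCompact_convexHull ℝ

theorem convex_edgeSegment (e : Sym2 G.nodes) : Convex ℝ (edgeSegment e) := by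
  induction e with
  | _ u v => exact convex_segment _ _

theorem isClosed_edgePts (e : Sym2 G.nodes) : IsClosed (G.edgePts e) :=
  (isCompact_edgeSegment e).isClosed.preimage continuous_subtype_val

theorem nodePt_mem_left {u v : G.nodes} : G.nodePt u ∈ G.edgePts s(u, v) :=
  left_mem_segment ℝ (u : EuclideanSpace ℝ (Fin n)) v

theorem nodePt_mem_right {u v : G.nodes} : G.nodePt v ∈ G.edgePts s(u, v) :=
  right_mem_segment ℝ (u : EuclideanSpace ℝ (Fin n)) v

instance : CompactSpace G.Pt := by
  refine isCompact_iff_compactSpace.1 ?_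
  have : G.carrier = (G.nodes : Set (EuclideanSpace ℝ (Fin n))) ∪
      ⋃ e ∈ G.graph.edgeSet, edgeSegment e := by
    ext x
    simp [carrier]
  rw [this]
  exact G.nodes.finite_toSet.isCompact.union
    ((Set.toFinite _).isCompact_biUnion fun e _ => isCompact_edgeSegment e)

namespace Path

/-- Concatenation of paths. -/
def append {x y z : G.Pt} (p : G.Path x y) (q : G.Path y z) : G.Path x z :=
  match p with
  | .nil _ => q
  | .cons e he x y _ hx hy p => .cons e he x y z hx hy (p.append q)

/-- The path consisting of one piece. -/
def single {e : Sym2 G.nodes} (he : e ∈ G.graph.edgeSet) {x y : G.Pt} (hx : x ∈ G.edgePts e)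
    (hy : y ∈ G.edgePts e) : G.Path x y :=
  .cons e he x y y hx hy (.nil y)

theorem length_append {x y z : G.Pt} (p : G.Path x y) (q : G.Path y z) :
    (p.append q).length = p.length + q.length := by
  induction p with
  | nil => simp [append, length]
  | cons e he x y _ hx hy p ih => simp [append, length, ih, add_assoc]

theorem length_single {e : Sym2 G.nodes} (he : e ∈ G.graph.edgeSet) {x y : G.Pt}
    (hx : x ∈ G.edgePts e) (hy : y ∈ G.edgePts e) :
    (single he hx hy).length = G.scale e * dist x y := by
  simp [single, length]

theorem length_nonneg {x y : G.Pt} (p : G.Path x y) : 0 ≤ p.length := by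
  induction p with
  | nil => exact le_rfl
  | cons e he x y _ hx hy p ih =>
    exact add_nonneg (mul_nonneg (scale_pos he).le dist_nonneg) ih

theorem exists_reverse {x y : G.Pt} (p : G.Path x y) : ∃ q : G.Path y x, q.length = p.length := by
  induction p with
  | nil x => exact ⟨.nil x, rfl⟩
  | cons e he x y _ hx hy p ih =>
    obtain ⟨q, hq⟩ := ih
    refine ⟨q.append (single he hy hx), ?_⟩
    rw [length_append, length_single, hq, dist_comm, length, add_comm]

theorem exists_of_walk {u v : G.nodes} (p : G.graph.Walk u v) :
    Nonempty (G.Path (G.nodePt u) (G.nodePt v)) := by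
  induction p with
  | nil => exact ⟨.nil _⟩
  | cons h p ih =>
    obtain ⟨q⟩ := ih
    exact ⟨.cons _ h _ _ _ nodePt_mem_left nodePt_mem_right q⟩

theorem exists_from_node (x : G.Pt) : ∃ v : G.nodes, Nonempty (G.Path (G.nodePt v) x) := by
  rcases x.2 with h | ⟨e, he, h⟩
  · exact ⟨⟨x, h⟩, ⟨.nil _⟩⟩
  · induction e with
    | _ u v => exact ⟨u, ⟨single he nodePt_mem_left h⟩⟩

instance (x y : G.Pt) : Nonempty (G.Path x y) := by
  obtain ⟨u, ⟨p⟩⟩ := exists_from_node x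
  obtain ⟨v, ⟨q⟩⟩ := exists_from_node y
  obtain ⟨w⟩ := G.connected.preconnected u v
  obtain ⟨r⟩ := exists_of_walk w
  obtain ⟨p', -⟩ := p.exists_reverse
  exact ⟨p'.append (r.append q)⟩

end Path

theorem graphDist_le_length {x y : G.Pt} (p : G.Path x y) : G.graphDist x y ≤ p.length :=
  ciInf_le ⟨0, by rintro _ ⟨q, rfl⟩; exact q.length_nonneg⟩ p

theorem graphDist_nonneg (x y : G.Pt) : 0 ≤ G.graphDist x y :=
  le_ciInf fun p => p.length_nonneg

theorem graphDist_self (x : G.Pt) : G.graphDist x x = 0 :=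
  le_antisymm (graphDist_le_length (.nil x)) (graphDist_nonneg x x)

theorem graphDist_comm (x y : G.Pt) : G.graphDist x y = G.graphDist y x := by
  have h : ∀ x y : G.Pt, G.graphDist x y ≤ G.graphDist y x := fun x y =>
    le_ciInf fun p => by
      obtain ⟨q, hq⟩ := p.exists_reverse
      exact hq ▸ graphDist_le_length q
  exact le_antisymm (h x y) (h y x)

theorem graphDist_triangle (x y z : G.Pt) :
    G.graphDist x z ≤ G.graphDist x y + G.graphDist y z :=
  le_ciInf_add_ciInf fun p q => Path.length_append p q ▸ graphDist_le_length (p.append q)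

theorem graphDist_le_of_mem {e : Sym2 G.nodes} (he : e ∈ G.graph.edgeSet) {x y : G.Pt}
    (hx : x ∈ G.edgePts e) (hy : y ∈ G.edgePts e) : G.graphDist x y ≤ G.scale e * dist x y :=
  Path.length_single he hx hy ▸ graphDist_le_length (Path.single he hx hy)

theorem abs_graphDist_sub_le (x y z : G.Pt) :
    |G.graphDist z x - G.graphDist z y| ≤ G.graphDist x y := by
  have h1 := graphDist_triangle z x y
  have h2 := graphDist_triangle z y x
  rw [graphDist_comm y x] at h2
  rw [abs_le]
  constructor <;> linarith

/-- The graph metric is continuous in the Euclidean topology: it is so on each of the finitely many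
closed pieces (edges and nodes) that cover the graph. -/
theorem continuous_graphDist_right (z : G.Pt) : Continuous fun x => G.graphDist z x := by
  let f : G.graph.edgeSet ⊕ G.nodes → Set G.Pt := Sum.elim (fun e => G.edgePts e)
    (fun v => {G.nodePt v})
  have hf : LocallyFinite f := locallyFinite_of_finite f
  refine hf.continuous ?_ ?_ ?_
  · refine eq_univ_of_forall fun x => mem_iUnion.2 ?_
    rcases x.2 with h | ⟨e, he, h⟩
    · exact ⟨Sum.inr ⟨x, h⟩, rfl⟩
    · exact ⟨Sum.inl ⟨e, he⟩, h⟩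
  · rintro (e | v)
    · exact isClosed_edgePts _
    · exact isClosed_singleton
  · rintro (e | v)
    · have : LipschitzOnWith (Real.toNNReal (G.scale e)) (fun x => G.graphDist z x)
          (G.edgePts e) := by
        refine LipschitzOnWith.of_dist_le_mul fun x hx y hy => ?_
        rw [Real.coe_toNNReal _ (scale_pos e.2).le]
        exact (abs_graphDist_sub_le x y z).trans (graphDist_le_of_mem e.2 hx hy)
      exact this.continuousOn
    · exact continuousOn_singleton _ _

theorem IsLipschitz.continuous {b : ℝ} {w : G.Pt → ℝ} (hw : G.IsLipschitz b w) :
    Continuous w := by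
  refine continuous_iff_continuousAt.2 fun x => ?_
  refine tendsto_iff_dist_tendsto_zero.2 ?_
  have h : Filter.Tendsto (fun y => b * G.graphDist x y) (nhds x) (nhds 0) := by
    have := ((continuous_graphDist_right x).tendsto x).const_mul b
    rwa [graphDist_self, mul_zero] at this
  refine squeeze_zero (fun _ => dist_nonneg) (fun y => ?_) h
  rw [graphDist_comm]
  exact hw y x

theorem continuous_graphDist : Continuous fun z : G.Pt × G.Pt => G.graphDist z.1 z.2 := by
  refine continuous_iff_continuousAt.2 fun ⟨x, y⟩ => ?_
  refine tendsto_iff_dist_tendsto_zero.2 ?_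
  have h : Filter.Tendsto (fun z : G.Pt × G.Pt => G.graphDist x z.1 + G.graphDist y z.2)
      (nhds (x, y)) (nhds 0) := by
    have hc : Continuous fun z : G.Pt × G.Pt => G.graphDist x z.1 + G.graphDist y z.2 :=
      ((continuous_graphDist_right x).comp continuous_fst).add
        ((continuous_graphDist_right y).comp continuous_snd)
    simpa [graphDist_self] using hc.tendsto (x, y)
  refine squeeze_zero (fun _ => dist_nonneg) (fun z => ?_) h
  have h1 := abs_graphDist_sub_le z.1 x z.2
  have h2 := abs_graphDist_sub_le z.2 y x
  rw [graphDist_comm z.2 z.1, graphDist_comm z.2 x, graphDist_comm z.1 x] at h1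
  rw [graphDist_comm z.2 y] at h2
  rw [Real.dist_eq, ← sub_add_sub_cancel _ (G.graphDist x z.2)]
  exact (abs_add_le _ _).trans (add_le_add h1 h2)

/-- The graph is cut into finitely many Borel cells, each within `r` of a centre. -/
theorem exists_measurable_near {r : ℝ} (hr : 0 < r) :
    ∃ (N : ℕ) (π : G.Pt → Fin N) (s : Fin N → G.Pt), Measurable π ∧
      ∀ x, G.graphDist (s (π x)) x < r := by
  obtain ⟨t, ht⟩ := isCompact_univ.elim_finite_subcover
    (fun y : G.Pt => {x | G.graphDist y x < r})
    (fun y => isOpen_lt (continuous_graphDist_right y) continuous_const)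
    (fun x _ => mem_iUnion.2 ⟨x, by simpa [graphDist_self] using hr⟩)
  have hex : ∀ x, ∃ m : ℕ, ∃ h : m < t.card, G.graphDist (t.equivFin.symm ⟨m, h⟩) x < r := by
    intro x
    obtain ⟨y, hy, hx⟩ := mem_iUnion₂.1 (ht (mem_univ x))
    refine ⟨t.equivFin ⟨y, hy⟩, (t.equivFin ⟨y, hy⟩).2, ?_⟩
    simpa using hx
  classical
  refine ⟨t.card, fun x => ⟨Nat.find (hex x), (Nat.find_spec (hex x)).1⟩,
    fun i => t.equivFin.symm i, ?_, fun x => (Nat.find_spec (hex x)).2⟩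
  have hm : Measurable fun x => Nat.find (hex x) := by
    refine measurable_find hex fun m => ?_
    by_cases h : m < t.card
    · simp only [h, exists_true_left]
      exact (isOpen_lt (continuous_graphDist_right _) continuous_const).measurableSet
    · simp [h]
  refine measurable_to_countable' fun i => ?_
  have : (fun x => (⟨Nat.find (hex x), (Nat.find_spec (hex x)).1⟩ : Fin t.card)) ⁻¹' {i} =
      (fun x => Nat.find (hex x)) ⁻¹' {(i : ℕ)} := by
    ext x
    simp [Fin.ext_iff]
  rw [this]
  exact hm (measurableSet_singleton _)

end PhysicalGraph

/-! ### The radial derivative of a Lipschitz function -/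

/-- If `ρ` has constant slope `c` on `[s, t]`, integrating `f' ρ'` recovers the increment of the
Lipschitz function `f`, up to the factor `c`. -/
theorem integral_deriv_mul_deriv_of_slope {f ρ : ℝ → ℝ} {C : NNReal} (hf : LipschitzWith C f)
    {s t c d : ℝ} (hst : s ≤ t) (hρ : ∀ τ ∈ Icc s t, ρ τ = c * τ + d) :
    ∫ τ in Icc s t, deriv f τ * deriv ρ τ = c * (f t - f s) := by
  have h1 : ∀ τ ∈ Ioo s t, deriv f τ * deriv ρ τ = c * deriv f τ := by
    intro τ hτ
    have h2 : deriv ρ τ = c := by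
      have h3 : ρ =ᶠ[nhds τ] fun τ => c * τ + d := by
        filter_upwards [Ioo_mem_nhds hτ.1 hτ.2] with σ hσ using hρ σ (Ioo_subset_Icc_self hσ)
      rw [h3.deriv_eq]
      simp
    rw [h2, mul_comm]
  rw [integral_Icc_eq_integral_Ioo, setIntegral_congr_fun measurableSet_Ioo h1,
    integral_const_mul, ← integral_Ioc_eq_integral_Ioo, ← intervalIntegral.integral_of_le hst,
    (hf.lipschitzOnWith (s := uIcc s t)).absolutelyContinuousOnInterval.integral_deriv_eq_sub]

namespace PhysicalGraph

variable {n : ℕ} {G : PhysicalGraph n}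

/-- The points of the graph on the line segment between two points. -/
def seg (x y : G.Pt) : Set G.Pt :=
  {z | (z : EuclideanSpace ℝ (Fin n)) ∈
    segment ℝ (x : EuclideanSpace ℝ (Fin n)) (y : EuclideanSpace ℝ (Fin n))}

theorem isClosed_seg (x y : G.Pt) : IsClosed (seg x y) := by
  refine IsClosed.preimage (t := segment ℝ (x : EuclideanSpace ℝ (Fin n)) y)
    continuous_subtype_val ?_
  rw [← convexHull_pair]
  exact ((Set.toFinite _).isCompact_convexHull ℝ).isClosed

theorem seg_subset_edgePts {e : Sym2 G.nodes} {x y : G.Pt} (hx : x ∈ G.edgePts e)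
    (hy : y ∈ G.edgePts e) : seg x y ⊆ G.edgePts e :=
  fun _ hz => (convex_edgeSegment e).segment_subset hx hy hz

theorem dist_add_dist_of_mem_seg {x y w : G.Pt} (h : w ∈ seg x y) :
    dist x w + dist w y = dist x y :=
  dist_add_dist_of_mem_segment h

/-- `Φ` parametrizes the edge `e` by Euclidean arc length over `[0, edgeEuclideanLength e]`, and
is constant on either side of that interval. -/
structure IsEdgeParam (e : Sym2 G.nodes) (Φ : ℝ → G.Pt) : Prop where
  lipschitz : LipschitzWith 1 Φ
  dist_eq : ∀ s ∈ Icc 0 (edgeEuclideanLength e), ∀ t ∈ Icc 0 (edgeEuclideanLength e),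
    dist (Φ s) (Φ t) = |s - t|
  mem : ∀ t, Φ t ∈ G.edgePts e
  surj : ∀ x ∈ G.edgePts e, ∃ t ∈ Icc 0 (edgeEuclideanLength e), Φ t = x
  mem_seg : ∀ s ∈ Icc 0 (edgeEuclideanLength e), ∀ t ∈ Icc 0 (edgeEuclideanLength e),
    ∀ r ∈ Icc 0 (edgeEuclideanLength e), Φ r ∈ seg (Φ s) (Φ t) ↔ r ∈ uIcc s t
  map_volume : (Measure.hausdorffMeasure 1).restrict (G.edgePts e) =
    (volume.restrict (Icc 0 (edgeEuclideanLength e))).map Φ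

theorem exists_isEdgeParam {e : Sym2 G.nodes} (he : e ∈ G.graph.edgeSet) :
    ∃ Φ : ℝ → G.Pt, IsEdgeParam e Φ := by
  have hL := edgeEuclideanLength_pos he
  induction e with
  | _ u v =>
  set L := edgeEuclideanLength s(u, v) with hLdef
  have hL' : L = dist (u : EuclideanSpace ℝ (Fin n)) v := rfl
  let ψ : ℝ →ᵃ[ℝ] EuclideanSpace ℝ (Fin n) :=
    AffineMap.lineMap (u : EuclideanSpace ℝ (Fin n))
      (u + L⁻¹ • ((v : EuclideanSpace ℝ (Fin n)) - u))
  have hψ : Isometry ψ := by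
    refine Isometry.of_dist_eq fun s t => ?_
    rw [dist_lineMap_lineMap, dist_self_add_right, norm_smul, ← dist_eq_norm,
      dist_comm (v : EuclideanSpace ℝ (Fin n)), ← hL', norm_inv, Real.norm_of_nonneg hL.le,
      inv_mul_cancel₀ hL.ne', mul_one]
  have hψ0 : ψ 0 = u := AffineMap.lineMap_apply_zero _ _
  have hψL : ψ L = v := by
    simp [ψ, AffineMap.lineMap_apply, smul_smul, mul_inv_cancel₀ hL.ne']
  have hseg : ∀ s t, segment ℝ (ψ s) (ψ t) = ψ '' uIcc s t := by
    intro s t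
    rw [← segment_eq_uIcc, image_segment]
  have hedge : edgeSegment s(u, v) = ψ '' Icc 0 L := by
    rw [← uIcc_of_le hL.le, ← hseg, hψ0, hψL]
    rfl
  have hmemψ : ∀ t, ψ (projIcc 0 L hL.le t) ∈ edgeSegment s(u, v) := fun t => by
    rw [hedge]
    exact mem_image_of_mem _ (projIcc 0 L hL.le t).2
  let Φ : ℝ → G.Pt := fun t => ⟨ψ (projIcc 0 L hL.le t), Or.inr ⟨_, he, hmemψ t⟩⟩
  have hΦ : ∀ t ∈ Icc 0 L, (Φ t : EuclideanSpace ℝ (Fin n)) = ψ t := fun t ht => by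
    simp only [Φ]
    rw [projIcc_of_mem hL.le ht]
  have hlip : LipschitzWith 1 Φ := by
    have h : LipschitzWith (1 * 1) (fun t => ψ (projIcc 0 L hL.le t)) :=
      hψ.lipschitz.comp (LipschitzWith.projIcc hL.le)
    rw [one_mul] at h
    exact fun s t => h s t
  refine ⟨Φ, hlip, ?_, hmemψ, ?_, ?_, ?_⟩
  · intro s hs t ht
    rw [Subtype.dist_eq, hΦ s hs, hΦ t ht, hψ.dist_eq, Real.dist_eq]
  · intro x hx
    have hx' : (x : EuclideanSpace ℝ (Fin n)) ∈ edgeSegment s(u, v) := hx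
    rw [hedge] at hx'
    obtain ⟨t, ht, htx⟩ := hx'
    exact ⟨t, ht, Subtype.ext ((hΦ t ht).trans htx)⟩
  · intro s hs t ht r hr
    change (Φ r : EuclideanSpace ℝ (Fin n)) ∈ segment ℝ (Φ s : EuclideanSpace ℝ (Fin n)) (Φ t) ↔ _
    rw [hΦ s hs, hΦ t ht, hΦ r hr, hseg, hψ.injective.mem_set_image]
  · refine Measure.ext fun S hS => ?_
    rw [Measure.restrict_apply hS, Measure.map_apply hlip.continuous.measurable hS,
      Measure.restrict_apply (hlip.continuous.measurable hS),
      ← isometry_subtype_coe.hausdorffMeasure_image (Or.inl zero_le_one),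
      ← hausdorffMeasure_real, ← hψ.hausdorffMeasure_image (Or.inl zero_le_one)]
    congr 1
    ext z
    constructor
    · rintro ⟨x, ⟨hxS, hx⟩, rfl⟩
      have hx' : (x : EuclideanSpace ℝ (Fin n)) ∈ edgeSegment s(u, v) := hx
      rw [hedge] at hx'
      obtain ⟨t, ht, htx⟩ := hx'
      have : Φ t = x := Subtype.ext ((hΦ t ht).trans htx)
      exact ⟨t, ⟨by rwa [mem_preimage, this], ht⟩, htx⟩
    · rintro ⟨t, ⟨htS, ht⟩, rfl⟩
      exact ⟨Φ t, ⟨htS, hmemψ t⟩, hΦ t ht⟩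

/-- The arc-length parametrization of an edge, in one of its two orientations. -/
noncomputable def edgeParam (e : G.graph.edgeSet) : ℝ → G.Pt :=
  (exists_isEdgeParam e.2).choose

theorem isEdgeParam_edgeParam (e : G.graph.edgeSet) :
    IsEdgeParam (e : Sym2 G.nodes) (edgeParam e) :=
  (exists_isEdgeParam e.2).choose_spec

/-- The derivative of `f`, at a point of the edge `e`, in the direction in which the distance from
`z` grows at unit speed. It is the product of the arc-length derivatives of `f` and of the distance
from `z`, both taken with respect to the length that the edge carries; thus the orientation of the
parametrization does not matter. -/
noncomputable def edgeRadialDeriv (z : G.Pt) (f : G.Pt → ℝ) (e : G.graph.edgeSet) (x : G.Pt) : ℝ :=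
  deriv (f ∘ edgeParam e) (dist (edgeParam e 0) x) *
    deriv (G.graphDist z ∘ edgeParam e) (dist (edgeParam e 0) x) / G.scale e ^ 2

/-- The derivative of `f` in the direction away from `z`. At the finitely many points that lie on
several edges the sum has no meaning, but these points do not matter for the length measure. -/
noncomputable def radialDeriv (z : G.Pt) (f : G.Pt → ℝ) (x : G.Pt) : ℝ :=
  ∑ᶠ e : G.graph.edgeSet, (G.edgePts e).indicator (edgeRadialDeriv z f e) x

theorem measurable_edgeRadialDeriv (z : G.Pt) (f : G.Pt → ℝ) (e : G.graph.edgeSet) :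
    Measurable (edgeRadialDeriv z f e) := by
  have hd : Measurable fun x => dist (edgeParam e 0) x := by fun_prop
  exact (((measurable_deriv _).comp hd).mul ((measurable_deriv _).comp hd)).div_const _

theorem measurable_radialDeriv (z : G.Pt) (f : G.Pt → ℝ) : Measurable (radialDeriv z f) := by
  have := Fintype.ofFinite G.graph.edgeSet
  unfold radialDeriv
  simp only [finsum_eq_sum_of_fintype]
  exact Finset.measurable_fun_sum _ fun e _ =>
    (measurable_edgeRadialDeriv z f e).indicator (isClosed_edgePts _).measurableSet

theorem IsLipschitz.comp_edgeParam {b : ℝ} (hb : 0 ≤ b) {f : G.Pt → ℝ} (hf : G.IsLipschitz b f)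
    (e : G.graph.edgeSet) :
    LipschitzWith (Real.toNNReal (b * G.scale e)) (f ∘ edgeParam e) := by
  have hs := (scale_pos e.2).le
  refine LipschitzWith.of_dist_le_mul fun s t => ?_
  rw [Real.coe_toNNReal _ (mul_nonneg hb hs)]
  have hp := isEdgeParam_edgeParam e
  have h1 := hp.lipschitz.dist_le_mul s t
  rw [NNReal.coe_one, one_mul] at h1
  calc dist (f (edgeParam e s)) (f (edgeParam e t))
      ≤ b * G.graphDist (edgeParam e s) (edgeParam e t) := hf _ _
    _ ≤ b * (G.scale e * dist (edgeParam e s) (edgeParam e t)) :=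
        mul_le_mul_of_nonneg_left (graphDist_le_of_mem e.2 (hp.mem _) (hp.mem _)) hb
    _ ≤ b * (G.scale e * dist s t) :=
        mul_le_mul_of_nonneg_left (mul_le_mul_of_nonneg_left h1 hs) hb
    _ = b * G.scale e * dist s t := by ring

theorem isLipschitz_graphDist (z : G.Pt) : G.IsLipschitz 1 (G.graphDist z) := fun x y => by
  rw [one_mul]
  exact abs_graphDist_sub_le x y z

theorem abs_edgeRadialDeriv_le {b : ℝ} (hb : 0 ≤ b) {f : G.Pt → ℝ} (hf : G.IsLipschitz b f)
    (z : G.Pt) (e : G.graph.edgeSet) (x : G.Pt) : |edgeRadialDeriv z f e x| ≤ b := by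
  have hs := scale_pos e.2
  have h1 := norm_deriv_le_of_lipschitz (x₀ := dist (edgeParam e 0) x) (hf.comp_edgeParam hb e)
  have h2 := norm_deriv_le_of_lipschitz (x₀ := dist (edgeParam e 0) x)
    ((isLipschitz_graphDist z).comp_edgeParam zero_le_one e)
  rw [Real.coe_toNNReal _ (by positivity), Real.norm_eq_abs] at h1 h2
  rw [edgeRadialDeriv, abs_div, abs_mul, abs_of_pos (pow_pos hs 2), div_le_iff₀ (pow_pos hs 2)]
  calc _ ≤ (b * G.scale e) * (1 * G.scale e) :=
        mul_le_mul h1 h2 (abs_nonneg _) (by positivity)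
    _ = b * G.scale e ^ 2 := by ring

/-- Two edges share at most one point, so almost every point of an edge lies on no other edge. -/
theorem ae_radialDeriv_eq (z : G.Pt) (f : G.Pt → ℝ) (e : G.graph.edgeSet) :
    ∀ᵐ x ∂(Measure.hausdorffMeasure 1 : Measure G.Pt).restrict (G.edgePts e),
      radialDeriv z f x = edgeRadialDeriv z f e x := by
  have := Measure.nullSingletonClass_hausdorff G.Pt (d := 1) zero_lt_one
  have hm : MeasurableSet (G.edgePts (e : Sym2 G.nodes)) := (isClosed_edgePts _).measurableSet
  have h : ∀ e' : G.graph.edgeSet, e' ≠ e →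
      ∀ᵐ x ∂(Measure.hausdorffMeasure 1 : Measure G.Pt).restrict (G.edgePts e),
        x ∉ G.edgePts (e' : Sym2 G.nodes) := by
    intro e' he
    rw [ae_restrict_iff' hm]
    have hsub : (G.edgePts (e : Sym2 G.nodes) ∩ G.edgePts (e' : Sym2 G.nodes)).Subsingleton :=
      fun x hx y hy => Subtype.ext (G.inter_subsingleton e e.2 e' e'.2
        (fun h => he (Subtype.ext h.symm)) hx hy)
    filter_upwards [compl_mem_ae_iff.2 (hsub.measure_zero (Measure.hausdorffMeasure 1))]
      with x hx h1 h2 using hx ⟨h1, h2⟩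
  filter_upwards [ae_restrict_mem hm, ae_all_iff.2 fun e' => ae_all_iff.2 (h e')] with x hx hx'
  rw [radialDeriv, finsum_eq_single _ e fun e' he => indicator_of_notMem (hx' e' he) _,
    indicator_of_mem hx]

theorem ae_abs_radialDeriv_le {b : ℝ} (hb : 0 ≤ b) {f : G.Pt → ℝ} (hf : G.IsLipschitz b f)
    (z : G.Pt) : ∀ᵐ x ∂G.lengthMeasure, ‖radialDeriv z f x‖ ≤ b := by
  rw [lengthMeasure, Measure.ae_sum_iff]
  intro e
  refine Measure.ae_smul_measure ?_ _
  filter_upwards [ae_radialDeriv_eq z f e] with x hx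
  rw [hx]
  exact abs_edgeRadialDeriv_le hb hf z e x

instance : IsFiniteMeasure G.lengthMeasure := by
  have := Fintype.ofFinite G.graph.edgeSet
  refine ⟨?_⟩
  rw [lengthMeasure, Measure.sum_apply _ MeasurableSet.univ, tsum_fintype]
  refine ENNReal.sum_lt_top.2 fun e _ => ?_
  rw [Measure.smul_apply, (isEdgeParam_edgeParam e).map_volume,
    Measure.map_apply (isEdgeParam_edgeParam e).lipschitz.continuous.measurable MeasurableSet.univ]
  exact ENNReal.mul_lt_top ENNReal.ofReal_lt_top (by simp)

theorem lengthMeasure_singleton (x : G.Pt) : G.lengthMeasure {x} = 0 := by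
  have := Measure.nullSingletonClass_hausdorff G.Pt (d := 1) zero_lt_one
  rw [lengthMeasure, Measure.sum_apply _ (measurableSet_singleton x)]
  simp

/-- Inside an edge only the length carried by that edge counts, since the other edges meet it in at
most one point. -/
theorem lengthMeasure_restrict {e : Sym2 G.nodes} (he : e ∈ G.graph.edgeSet) {S : Set G.Pt}
    (hS : MeasurableSet S) (hSe : S ⊆ G.edgePts e) :
    G.lengthMeasure.restrict S =
      ENNReal.ofReal (G.scale e) • (Measure.hausdorffMeasure 1).restrict S := by
  have := Measure.nullSingletonClass_hausdorff G.Pt (d := 1) zero_lt_one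
  refine Measure.ext fun T hT => ?_
  rw [Measure.restrict_apply hT, lengthMeasure, Measure.sum_apply _ (hT.inter hS),
    tsum_eq_single ⟨e, he⟩]
  · rw [Measure.smul_apply, Measure.smul_apply, Measure.restrict_apply (hT.inter hS),
      Measure.restrict_apply hT, inter_eq_left.2 (inter_subset_right.trans hSe)]
  · intro e' hne
    have hsub : (T ∩ S ∩ G.edgePts (e' : Sym2 G.nodes)).Subsingleton :=
      fun x hx y hy => Subtype.ext (G.inter_subsingleton e he e' e'.2
        (fun h => hne (Subtype.ext h.symm)) ⟨hSe hx.1.2, hx.2⟩ ⟨hSe hy.1.2, hy.2⟩)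
    rw [Measure.smul_apply, Measure.restrict_apply (hT.inter hS), hsub.measure_zero, smul_zero]

/-- Along a piece of a shortest path, the distance from the root grows at unit speed at every
point. -/
theorem graphDist_eq_of_mem_seg {z x y w : G.Pt} {e : Sym2 G.nodes} (he : e ∈ G.graph.edgeSet)
    (hx : x ∈ G.edgePts e) (hy : y ∈ G.edgePts e)
    (h : G.graphDist z y = G.graphDist z x + G.scale e * dist x y) (hw : w ∈ seg x y) :
    G.graphDist z w = G.graphDist z x + G.scale e * dist x w := by
  have hwe := seg_subset_edgePts hx hy hw
  have h1 := graphDist_triangle z x w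
  have h2 := graphDist_le_of_mem he hx hwe
  have h3 := graphDist_triangle z w y
  have h4 := graphDist_le_of_mem he hwe hy
  rw [← dist_add_dist_of_mem_seg hw, mul_add] at h
  linarith

/-- On a piece of a shortest path from `z`, integrating the radial derivative gives the increment of
`f`, whichever way the piece runs through the parametrized edge. -/
theorem setIntegral_seg_radialDeriv {b : ℝ} (hb : 0 ≤ b) {f : G.Pt → ℝ} (hf : G.IsLipschitz b f)
    {z x y : G.Pt} {e : Sym2 G.nodes} (he : e ∈ G.graph.edgeSet)
    (hx : x ∈ G.edgePts e) (hy : y ∈ G.edgePts e)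
    (h : G.graphDist z y = G.graphDist z x + G.scale e * dist x y) :
    ∫ w in seg x y, radialDeriv z f w ∂G.lengthMeasure = f y - f x := by
  have hs := scale_pos he
  have hp : IsEdgeParam e (edgeParam ⟨e, he⟩) := isEdgeParam_edgeParam ⟨e, he⟩
  set Φ := edgeParam ⟨e, he⟩ with hΦ
  set L := edgeEuclideanLength e with hL
  have hL0 : 0 < L := edgeEuclideanLength_pos he
  have hmeas : MeasurableSet (seg x y) := (isClosed_seg x y).measurableSet
  have hsub := seg_subset_edgePts hx hy
  rw [lengthMeasure_restrict he hmeas hsub, integral_smul_measure, ENNReal.toReal_ofReal hs.le,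
    ← inter_eq_left.2 hsub, ← Measure.restrict_restrict hmeas, smul_eq_mul,
    integral_congr_ae (ae_restrict_of_ae (ae_radialDeriv_eq z f ⟨e, he⟩))]
  obtain ⟨s, hs', rfl⟩ := hp.surj x hx
  obtain ⟨t, ht', rfl⟩ := hp.surj y hy
  have hΦm : Measurable Φ := hp.lipschitz.continuous.measurable
  rw [hp.map_volume, setIntegral_map hmeas
    (measurable_edgeRadialDeriv z f _).aestronglyMeasurable hΦm.aemeasurable,
    Measure.restrict_restrict (hΦm hmeas)]
  have hset : Φ ⁻¹' seg (Φ s) (Φ t) ∩ Icc 0 L = uIcc s t := by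
    ext r
    constructor
    · rintro ⟨hr, hrL⟩
      exact (hp.mem_seg s hs' t ht' r hrL).1 hr
    · intro hr
      have hrL : r ∈ Icc 0 L := (ordConnected_Icc.uIcc_subset hs' ht') hr
      exact ⟨(hp.mem_seg s hs' t ht' r hrL).2 hr, hrL⟩
  have hval : ∀ r ∈ uIcc s t, edgeRadialDeriv z f ⟨e, he⟩ (Φ r) =
      deriv (f ∘ Φ) r * deriv (G.graphDist z ∘ Φ) r / G.scale e ^ 2 := by
    intro r hr
    have hrL : r ∈ Icc 0 L := (ordConnected_Icc.uIcc_subset hs' ht') hr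
    have : dist (Φ 0) (Φ r) = r := by
      rw [hp.dist_eq 0 ⟨le_rfl, hL0.le⟩ r hrL, zero_sub, abs_neg, abs_of_nonneg hrL.1]
    simp only [edgeRadialDeriv, ← hΦ, this]
  have hρ : ∀ r ∈ uIcc s t, (G.graphDist z ∘ Φ) r = G.graphDist z (Φ s) + G.scale e * |s - r| := by
    intro r hr
    have hrL : r ∈ Icc 0 L := (ordConnected_Icc.uIcc_subset hs' ht') hr
    rw [← hp.dist_eq s hs' r hrL]
    exact graphDist_eq_of_mem_seg he hx hy h ((hp.mem_seg s hs' t ht' r hrL).2 hr)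
  rw [hset, setIntegral_congr_fun measurableSet_uIcc hval, integral_div]
  have hlip : LipschitzWith _ (f ∘ Φ) := hf.comp_edgeParam hb ⟨e, he⟩
  rcases le_total s t with hst | hst
  · rw [uIcc_of_le hst] at hρ ⊢
    rw [integral_deriv_mul_deriv_of_slope hlip hst (c := G.scale e)
      (d := G.graphDist z (Φ s) - G.scale e * s)
      fun r hr => by rw [hρ r hr, abs_of_nonpos (sub_nonpos.2 hr.1)]; ring]
    simp only [Function.comp]
    field_simp
  · rw [uIcc_of_ge hst] at hρ ⊢
    rw [integral_deriv_mul_deriv_of_slope hlip hst (c := -G.scale e)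
      (d := G.graphDist z (Φ s) + G.scale e * s)
      fun r hr => by rw [hρ r hr, abs_of_nonneg (sub_nonneg.2 hr.2)]; ring]
    simp only [Function.comp]
    field_simp
    ring

namespace Path

theorem measurableSet_support {x y : G.Pt} (p : G.Path x y) : MeasurableSet p.support := by
  induction p with
  | nil x => exact measurableSet_singleton x
  | cons e he x y _ hx hy p ih => exact (isClosed_seg x y).measurableSet.union ih

theorem graphDist_le_add_length {x y : G.Pt} (z : G.Pt) (p : G.Path x y) :
    G.graphDist z y ≤ G.graphDist z x + p.length :=
  (graphDist_triangle z x y).trans (by linarith [graphDist_le_length p])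

/-- Both parts of a path along which the distance from `z` grows at unit speed have that
property. -/
theorem tight_of_cons {z x y t : G.Pt} {e : Sym2 G.nodes} (he : e ∈ G.graph.edgeSet)
    (hx : x ∈ G.edgePts e) (hy : y ∈ G.edgePts e) (p : G.Path y t)
    (h : G.graphDist z t = G.graphDist z x + (cons e he x y t hx hy p).length) :
    G.graphDist z y = G.graphDist z x + G.scale e * dist x y ∧
      G.graphDist z t = G.graphDist z y + p.length := by
  rw [length] at h
  have h1 := graphDist_triangle z x y
  have h2 := graphDist_le_of_mem he hx hy
  have h3 := p.graphDist_le_add_length z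
  constructor <;> linarith

theorem graphDist_le_of_mem_support {z x y : G.Pt} (p : G.Path x y)
    (h : G.graphDist z y = G.graphDist z x + p.length) {w : G.Pt} (hw : w ∈ p.support) :
    G.graphDist z x ≤ G.graphDist z w := by
  induction p with
  | nil x => exact le_of_eq (by rw [mem_singleton_iff.1 hw])
  | cons e he x y t hx hy p ih =>
    obtain ⟨h1, h2⟩ := tight_of_cons he hx hy p h
    have hd := mul_nonneg (scale_pos he).le (dist_nonneg (x := x) (y := y))
    rcases hw with hw | hw
    · rw [graphDist_eq_of_mem_seg he hx hy h1 hw]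
      exact le_add_of_nonneg_right (mul_nonneg (scale_pos he).le dist_nonneg)
    · have := ih h2 hw
      linarith

/-- The first piece of a shortest path meets the rest only at its end-point, so that the
integral over the support is the sum of the integrals over the pieces. -/
theorem setIntegral_support_radialDeriv {b : ℝ} (hb : 0 ≤ b) {f : G.Pt → ℝ}
    (hf : G.IsLipschitz b f) {z x y : G.Pt} (hint : Integrable (radialDeriv z f) G.lengthMeasure)
    (p : G.Path x y) (h : G.graphDist z y = G.graphDist z x + p.length) :
    ∫ w in p.support, radialDeriv z f w ∂G.lengthMeasure = f y - f x := by
  induction p with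
  | nil x =>
    rw [support, setIntegral_measure_zero _ (lengthMeasure_singleton x), sub_self]
  | cons e he x y t hx hy p ih =>
    obtain ⟨h1, h2⟩ := tight_of_cons he hx hy p h
    have hdisj : AEDisjoint G.lengthMeasure (seg x y) p.support := by
      refine measure_mono_null ?_ (lengthMeasure_singleton y)
      rintro w ⟨hw, hw'⟩
      have e1 := graphDist_eq_of_mem_seg he hx hy h1 hw
      have e2 := p.graphDist_le_of_mem_support h2 hw'
      rw [← dist_add_dist_of_mem_seg hw, mul_add] at h1
      have e3 : G.scale e * dist w y ≤ G.scale e * 0 := by linarith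
      exact dist_le_zero.1 (le_of_mul_le_mul_left e3 (scale_pos he))
    change ∫ w in seg x y ∪ p.support, _ ∂_ = _
    rw [setIntegral_union₀ hdisj p.measurableSet_support.nullMeasurableSet hint.integrableOn
      hint.integrableOn, setIntegral_seg_radialDeriv hb hf he hx hy h1, ih h2]
    ring

end Path

/-- A `b`-Lipschitz function has a graph derivative bounded by `b`. -/
theorem IsLipschitz.isGraphDeriv_radialDeriv {b : ℝ} (hb : 0 ≤ b) {f : G.Pt → ℝ}
    (hf : G.IsLipschitz b f) (z₀ : G.nodes) :
    G.IsGraphDeriv z₀ G.lengthMeasure ∞ f (radialDeriv (G.nodePt z₀) f) ∧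
      eLpNorm (radialDeriv (G.nodePt z₀) f) ∞ G.lengthMeasure ≤ ENNReal.ofReal b := by
  have hbound := ae_abs_radialDeriv_le hb hf (G.nodePt z₀)
  have hm := (measurable_radialDeriv (G.nodePt z₀) f).aestronglyMeasurable (μ := G.lengthMeasure)
  have hLp : MemLp (radialDeriv (G.nodePt z₀) f) ∞ G.lengthMeasure :=
    memLp_top_of_bound hm b hbound
  have hint : Integrable (radialDeriv (G.nodePt z₀) f) G.lengthMeasure := hLp.integrable le_top
  refine ⟨⟨hLp, fun x P hP => ⟨hint.integrableOn, ?_⟩⟩, ?_⟩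
  · refine (P.setIntegral_support_radialDeriv hb hf hint ?_).symm
    rw [graphDist_self, zero_add, hP]
  · rw [eLpNorm_exponent_top]
    exact eLpNormEssSup_le_of_ae_bound hbound

end PhysicalGraph

/-! ### From dual potentials to a critic -/

theorem Continuous.integrable_of_compactSpace {X : Type*} [TopologicalSpace X]
    [CompactSpace X] [MeasurableSpace X] [OpensMeasurableSpace X] {f : X → ℝ} (hf : Continuous f)
    (μ : Measure X) [IsFiniteMeasure μ] : Integrable f μ :=
  hf.integrable_of_hasCompactSupport (HasCompactSupport.of_compactSpace f)

theorem integral_add_add_const {X : Type*} [MeasurableSpace X] {μ : Measure X} [IsFiniteMeasure μ]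
    {f g : X → ℝ} (hf : Integrable f μ) (hg : Integrable g μ) (c : ℝ) :
    ∫ x, (f x + g x + c) ∂μ = ∫ x, f x ∂μ + ∫ x, g x ∂μ + μ.real univ * c := by
  have h : Integrable (fun x => f x + g x) μ := hf.add hg
  rw [integral_add h (integrable_const _), integral_add hf hg, integral_const, smul_eq_mul]

namespace PhysicalGraph

variable {n : ℕ} {G : PhysicalGraph n}

theorem IsLipschitz.min {b : ℝ} {f g : G.Pt → ℝ} (hf : G.IsLipschitz b f)
    (hg : G.IsLipschitz b g) : G.IsLipschitz b fun x => min (f x) (g x) := fun x y =>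
  (abs_min_sub_min_le_max _ _ _ _).trans (max_le (hf x y) (hg x y))

theorem IsLipschitz.add_const {b : ℝ} {f : G.Pt → ℝ} (hf : G.IsLipschitz b f) (c : ℝ) :
    G.IsLipschitz b fun x => f x + c := fun x y => by
  rw [add_sub_add_right_eq_sub]
  exact hf x y

/-- The `c`-transform for the cost `c = b d` is `b`-Lipschitz. -/
theorem isLipschitz_iInf {b : ℝ} (hb : 0 ≤ b) {g : G.Pt → ℝ}
    (hg : ∀ x, BddBelow (range fun y => b * G.graphDist x y - g y)) :
    G.IsLipschitz b fun x => ⨅ y, (b * G.graphDist x y - g y) := by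
  have key : ∀ x y, (⨅ t, (b * G.graphDist x t - g t)) - b * G.graphDist x y ≤
      ⨅ t, (b * G.graphDist y t - g t) := by
    intro x y
    have : Nonempty G.Pt := ⟨x⟩
    refine le_ciInf fun t => ?_
    have h1 := ciInf_le (hg x) t
    have h2 := mul_le_mul_of_nonneg_left (graphDist_triangle x y t) hb
    rw [mul_add] at h2
    linarith
  intro x y
  have h1 := key x y
  have h2 := key y x
  rw [graphDist_comm y x] at h2
  rw [abs_le]
  constructor <;> linarith

/-- The cost of moving a unit of mass from `x` to `y`, relative to leaving it where it is. -/
noncomputable def reducedCost (b lam : ℝ) (w₁ w₂ : G.Pt → ℝ) (z : G.Pt × G.Pt) : ℝ :=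
  b * (G.graphDist z.1 z.2 - lam) - w₁ z.1 - w₂ z.2

section

variable {b lam : ℝ} {w₁ w₂ : G.Pt → ℝ}

theorem continuous_reducedCost (hL₁ : G.IsLipschitz b w₁) (hL₂ : G.IsLipschitz b w₂) :
    Continuous (reducedCost b lam w₁ w₂) :=
  ((continuous_const.mul (continuous_graphDist.sub continuous_const)).sub
    (hL₁.continuous.comp continuous_fst)).sub (hL₂.continuous.comp continuous_snd)

theorem abs_reducedCost_sub_le (hb : 0 ≤ b) (hL₁ : G.IsLipschitz b w₁)
    (hL₂ : G.IsLipschitz b w₂) (x y x' y' : G.Pt) :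
    |reducedCost b lam w₁ w₂ (x, y) - reducedCost b lam w₁ w₂ (x', y')| ≤
      2 * b * (G.graphDist x' x + G.graphDist y' y) := by
  have h1 := abs_le.1 (hL₁ x' x)
  have h2 := abs_le.1 (hL₂ y' y)
  have h3 := mul_le_mul_of_nonneg_left (graphDist_triangle x x' y) hb
  have h4 := mul_le_mul_of_nonneg_left (graphDist_triangle x' y' y) hb
  have h5 := mul_le_mul_of_nonneg_left (graphDist_triangle x' x y') hb
  have h6 := mul_le_mul_of_nonneg_left (graphDist_triangle x y y') hb
  rw [graphDist_comm x x'] at h3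
  rw [graphDist_comm y y'] at h6
  rw [reducedCost, reducedCost, abs_le]
  constructor <;> linarith

/-- The cost of a sub-coupling is a constant plus its integral of the reduced cost. -/
theorem eptCost_eq (hL₁ : G.IsLipschitz b w₁) (hL₂ : G.IsLipschitz b w₂)
    (μ ν : Measure G.Pt) (γ : Measure (G.Pt × G.Pt)) [IsFiniteMeasure γ] :
    eptCost b lam w₁ w₂ G.graphDist μ ν γ =
      ∫ x, w₁ x ∂μ + ∫ y, w₂ y ∂ν + ∫ z, reducedCost b lam w₁ w₂ z ∂γ := by
  have c1 := hL₁.continuous.comp (continuous_fst (X := G.Pt) (Y := G.Pt))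
  have c2 := hL₂.continuous.comp (continuous_snd (X := G.Pt) (Y := G.Pt))
  have c3 : Continuous fun z : G.Pt × G.Pt => b * (G.graphDist z.1 z.2 - lam) :=
    continuous_const.mul (continuous_graphDist.sub continuous_const)
  have e1 : ∫ x, w₁ x ∂γ.fst = ∫ z, w₁ z.1 ∂γ :=
    integral_map measurable_fst.aemeasurable hL₁.continuous.aestronglyMeasurable
  have e2 : ∫ x, w₂ x ∂γ.snd = ∫ z, w₂ z.2 ∂γ :=
    integral_map measurable_snd.aemeasurable hL₂.continuous.aestronglyMeasurable
  have e3 : ∫ z, reducedCost b lam w₁ w₂ z ∂γ =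
      ∫ z, b * (G.graphDist z.1 z.2 - lam) ∂γ - ∫ z, w₁ z.1 ∂γ - ∫ z, w₂ z.2 ∂γ := by
    have i1 : Integrable (fun z : G.Pt × G.Pt => w₁ z.1) γ := c1.integrable_of_compactSpace γ
    have i2 : Integrable (fun z : G.Pt × G.Pt => w₂ z.2) γ := c2.integrable_of_compactSpace γ
    have i3 := c3.integrable_of_compactSpace γ
    rw [← integral_sub i3 i1]
    exact integral_sub (i3.sub i1) i2
  rw [eptCost, e1, e2, e3, integral_const_mul]
  ring

/-- A pair `(u, v)` of dual potentials is turned into one `b`-Lipschitz critic: the `c`-transform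
of the second potential, cut off at the largest value that the first may take. -/
theorem exists_isLipschitz_of_dual (hb : 0 ≤ b) (hL₁ : G.IsLipschitz b w₁)
    (hL₂ : G.IsLipschitz b w₂) {u v : G.Pt → ℝ} (hu : ∀ x, u x ≤ 0) (hv : ∀ y, v y ≤ 0)
    (huv : ∀ x y, u x + v y ≤ reducedCost b lam w₁ w₂ (x, y)) :
    ∃ f : G.Pt → ℝ, G.IsLipschitz b f ∧ (∀ x, w₁ x + u x + b * lam / 2 ≤ f x) ∧
      (∀ y, w₂ y + v y + b * lam / 2 ≤ -f y) ∧ (∀ x, f x ≤ w₁ x + b * lam / 2) ∧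
      ∀ x, min (-w₂ x - b * lam / 2) (w₁ x + b * lam / 2) ≤ f x := by
  set g : G.Pt → ℝ := fun y => w₂ y + v y + b * lam / 2 with hg
  have hlow : ∀ x y, -w₂ x - b * lam / 2 ≤ b * G.graphDist x y - g y := by
    intro x y
    have h1 := abs_le.1 (hL₂ x y)
    have h2 := hv y
    simp only [hg]
    linarith
  have hbdd : ∀ x, BddBelow (range fun y => b * G.graphDist x y - g y) := fun x =>
    ⟨_, by rintro _ ⟨y, rfl⟩; exact hlow x y⟩
  refine ⟨fun x => min (⨅ y, (b * G.graphDist x y - g y)) (w₁ x + b * lam / 2),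
    (isLipschitz_iInf hb hbdd).min (hL₁.add_const _), fun x => le_min ?_ ?_, fun y => ?_,
    fun x => min_le_right _ _, fun x => min_le_min_right _ ?_⟩
  · have : Nonempty G.Pt := ⟨x⟩
    refine le_ciInf fun y => ?_
    have := huv x y
    simp only [reducedCost] at this
    simp only [hg]
    linarith
  · have := hu x
    linarith
  · refine le_neg_of_le_neg ((min_le_left _ _).trans ((ciInf_le (hbdd y) y).trans ?_))
    rw [graphDist_self, mul_zero, zero_sub]
  · have : Nonempty G.Pt := ⟨x⟩
    exact le_ciInf (hlow x)

/-- Duality up to `ε`: the value of some critic falls short of the shifted cost of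
some sub-coupling by at most `ε`. -/
theorem exists_critic_subCoupling (z₀ : G.nodes) (hb : 0 ≤ b) (hL₁ : G.IsLipschitz b w₁)
    (hL₂ : G.IsLipschitz b w₂)
    (hlam : 0 ≤ (b * lam + w₁ (G.nodePt z₀) + w₂ (G.nodePt z₀)) / 2)
    (μ ν : Measure G.Pt) [IsFiniteMeasure μ] [IsFiniteMeasure ν] {ε : ℝ} (hε : 0 < ε) :
    ∃ f ∈ G.criticSet z₀ G.lengthMeasure b lam w₁ w₂ ∞ 0, ∃ γ ∈ subCouplings μ ν,
      eptCost b lam w₁ w₂ G.graphDist μ ν γ + b * lam / 2 * (μ.real univ + ν.real univ) ≤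
        ∫ x, f x ∂μ - ∫ x, f x ∂ν + ε := by
  set ε' := ε / (μ.real univ + 1) with hε'
  have hμ0 : 0 < μ.real univ + 1 := by positivity
  have hε'0 : 0 < ε' := div_pos hε hμ0
  -- the radius makes the reduced cost vary by at most `ε' / 2` around each pair of centres
  obtain ⟨N, π, s, hπ, hs⟩ := exists_measurable_near (G := G) (r := ε' / (8 * (b + 1)))
    (by positivity)
  have hclose : ∀ x y, |reducedCost b lam w₁ w₂ (x, y) -
      reducedCost b lam w₁ w₂ (s (π x), s (π y))| ≤ ε' / 2 := by
    intro x y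
    refine (abs_reducedCost_sub_le hb hL₁ hL₂ x y _ _).trans ?_
    calc _ ≤ 2 * (b + 1) * (ε' / (8 * (b + 1)) + ε' / (8 * (b + 1))) := by
          refine mul_le_mul (by linarith) (add_le_add (hs x).le (hs y).le)
            (add_nonneg (graphDist_nonneg _ _) (graphDist_nonneg _ _)) (by positivity)
      _ = ε' / 2 := by
          field_simp
          ring
  obtain ⟨γ, hγ, u, v, hui, hvi, hu, hv, huv, hval⟩ := exists_subCoupling_integral_le μ ν hπ
    (k := reducedCost b lam w₁ w₂)
    (fun γ _ => (continuous_reducedCost hL₁ hL₂).integrable_of_compactSpace γ)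
    (κ := fun i j => reducedCost b lam w₁ w₂ (s i, s j) - ε' / 2) hε'0
    (fun x y => by linarith [(abs_le.1 (hclose x y)).1])
    (fun x y => by linarith [(abs_le.1 (hclose x y)).2])
  obtain ⟨f, hfL, hf1, hf2, hf3, hf4⟩ := exists_isLipschitz_of_dual hb hL₁ hL₂ hu hv huv
  have hderiv := hfL.isGraphDeriv_radialDeriv hb z₀
  refine ⟨f, ⟨⟨hfL.continuous, _, hderiv.1⟩, ⟨?_, ?_⟩, _, hderiv⟩, γ, hγ, ?_⟩
  · have := hf4 (G.nodePt z₀)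
    -- `hlam` says that at the root the cut-off lies above the lower bound imposed on critics
    rw [min_eq_left (by linarith)] at this
    linarith
  · linarith [hf3 (G.nodePt z₀)]
  · have := hγ.1
    have hfi := fun (η : Measure G.Pt) [IsFiniteMeasure η] =>
      hfL.continuous.integrable_of_compactSpace η
    have i1 := hL₁.continuous.integrable_of_compactSpace μ
    have i2 := hL₂.continuous.integrable_of_compactSpace ν
    have e1 := integral_add_add_const i1 hui (b * lam / 2)
    have e2 := integral_add_add_const i2 hvi (b * lam / 2)
    have h1 := integral_mono ((i1.add hui).add (integrable_const _)) (hfi μ) hf1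
    have h2 := integral_mono ((i2.add hvi).add (integrable_const _)) (hfi ν).neg hf2
    have h1' := e1 ▸ h1
    have h2' := e2 ▸ h2
    have h3 : ∫ y, (-f) y ∂ν = - ∫ y, f y ∂ν := integral_neg _
    have h4 : ε' * (μ.real univ + 1) = ε := div_mul_cancel₀ _ hμ0.ne'
    rw [eptCost_eq hL₁ hL₂]
    rw [h3] at h2'
    rw [h4] at hval
    linarith

end

end PhysicalGraph

theorem proposition5p3 {n : ℕ} (G : PhysicalGraph n) (z₀ : G.nodes)
    (hz₀ : G.IsUniquePathRoot z₀)
    (b lam : ℝ) (hb : 0 ≤ b) (w₁ w₂ : G.Pt → ℝ)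
    (hw₁ : ∀ x, 0 ≤ w₁ x) (hw₂ : ∀ x, 0 ≤ w₂ x)
    (hL₁ : G.IsLipschitz b w₁) (hL₂ : G.IsLipschitz b w₂)
    (hlam : 0 ≤ (b * lam + w₁ (G.nodePt z₀) + w₂ (G.nodePt z₀)) / 2)
    (μ ν : Measure G.Pt) [IsFiniteMeasure μ] [IsFiniteMeasure ν] :
    G.US z₀ G.lengthMeasure b lam w₁ w₂ 1 0 μ ν ≥
      G.ET b lam w₁ w₂ μ ν +
        ((b * lam / 2 * (μ.real univ + ν.real univ) : ℝ) : EReal) := by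
  refine le_of_not_gt fun hlt => ?_
  obtain ⟨p, hp, hp'⟩ := EReal.lt_iff_exists_real_btwn.1 hlt
  obtain ⟨q, hq, hq'⟩ := EReal.lt_iff_exists_real_btwn.1 hp'
  obtain ⟨f, hf, γ, hγ, hle⟩ := PhysicalGraph.exists_critic_subCoupling z₀ hb hL₁ hL₂ hlam μ ν
    (sub_pos.2 (EReal.coe_lt_coe_iff.1 hq))
  have hexp : ENNReal.conjExponent 1 = ∞ := by simp [ENNReal.conjExponent]
  have hUS : ((∫ x, f x ∂μ - ∫ x, f x ∂ν : ℝ) : EReal) ≤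
      G.US z₀ G.lengthMeasure b lam w₁ w₂ 1 0 μ ν := by
    rw [PhysicalGraph.US, hexp]
    exact le_iSup₂_of_le f hf le_rfl
  have hET : G.ET b lam w₁ w₂ μ ν ≤ ((eptCost b lam w₁ w₂ G.graphDist μ ν γ : ℝ) : EReal) :=
    iInf₂_le_of_le γ hγ le_rfl
  have h1 := EReal.coe_lt_coe_iff.1 (hUS.trans_lt hp)
  have h2 := hq'.trans_le (add_le_add_left hET _)
  rw [← EReal.coe_add, EReal.coe_lt_coe_iff] at h2
  linarith
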